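/- All vector spaces are over $\mathbb{C}$; $\mathbb{C}^n$ carries the Euclidean norm, $\mathbb{M}_{m,n}$ denotes the complex $m\times n$ matrices with the operator norm from $\mathbb{C}^n$ to $\mathbb{C}^m$, and $M_{m,n}(V)$ the $m\times n$ matrices over a vector space $V$. A \emph{matrix-norm} on $V$ is a family of norms $\|\cdot\|_{V,m,n}$ on $M_{m,n}(V)$ with $\|ABC\|_{V,k,l}\le\|A\|_{\mathbb{M}_{k,m}}\|B\|_{V,m,n}\|C\|_{\mathbb{M}_{n,l}}$ for all $A\in\mathbb{M}_{k,m}$, $B\in M_{m,n}(V)$, $C\in\mathbb{M}_{n,l}$. A matrix-normed space $V$ is normed by $\|\cdot\|_{V,1,1}$; it is a \emph{matricial Banach space} if it is complete. The completion of a matrix-normed space carries the matrix-norms obtained by taking limits along entrywise convergent sequences. A linear map $\phi:V\to W$ of matrix-normed spaces is \emph{completely contractive} if $\|(\phi(A_{ij}))_{ij}\|_{W,m,n}\le\|A\|_{V,m,n}$ for all $m,n$ and all $A\in M_{m,n}(V)$. For a Banach space $V$, $\mathrm{AMAX}(V)$ is $V$ with the matrix-norm \[ \|A\|_{\mathrm{AMAX}(V),m,n}=\inf\Big\{\sum_{l=1}^{p}\|v_l\|_V\,\|C_l\|_{\mathbb{M}_{n,m}^{*}}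 : A=\sum_{l=1}^{p}v_l\otimes C_l,\ v_l\in V,\ C_l\in\mathbb{M}_{m,n}\Big\}, \] where $\|C\|_{\mathbb{M}_{n,m}^{*}}$ is the trace norm of $C$, that is, the norm of the functional $D\mapsto\operatorname{tr}(CD)$ on $\mathbb{M}_{n,m}$. The projective tensor product $V\hat\otimes W$ of Banach spaces is the completion of $V\otimes W$ for the norm $\|x\|=\inf\{\sum_l\|v_l\|\|w_l\| : x=\sum_l v_l\otimes w_l\}$ (finite sums). For matricial Banach spaces $V,W$, the Haagerup tensor product $V\otimes_h W$ is the completion of $V\otimes W$ for the matrix-norm \[ \|C\|_{V\otimes_h W,m,n}=\inf\Big\{\sum_{l=1}^{p}\|A_l\|_{V,m,q_l}\|B_l\|_{W,q_l,n} : C=\sum_{l=1}^{p}A_l\odot B_l\Big\}, \] over $p,q_l\in\mathbb{N}$, $A_l\in M_{m,q_l}(V)$, $B_l\in M_{q_l,n}(W)$, where $(A\odot B)(i,k)=\sum_j A(i,j)\otimes B(j,k)$. \textbf{Theorem.} Let $V$ and $W$ be Banach spaces. Then $\mathrm{AMAX}(V\hat\otimes W)$ and $\mathrm{AMAX}(V)\otimes_h\mathrm{AMAX}(W)$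 are completely isometrically isomorphic: there is a linear bijection \[ \Phi:\mathrm{AMAX}(V\hat\otimes W)\to\mathrm{AMAX}(V)\otimes_h\mathrm{AMAX}(W) \] such that $\Phi$ and $\Phi^{-1}$ are both completely contractive. -/

import Mathlib

open scoped TensorProduct

/-! ### Scalar matrices -/

section Scalar

open scoped Matrix.Norms.L2Operator

/-- The operator norm of an `m × n` matrix as a map from `ℂⁿ` to `ℂᵐ` with Euclidean norms. -/
noncomputable def opNorm {m n : ℕ} (A : Matrix (Fin m) (Fin n) ℂ) : ℝ := ‖A‖

/-- The linear functional `D ↦ tr (C D)` on the `n × m` matrices, for an `m × n` matrix `C`,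
as an element of the dual of the `n × m` matrices with the operator norm. -/
noncomputable def traceFunctional {m n : ℕ} (C : Matrix (Fin m) (Fin n) ℂ) :
    StrongDual ℂ (Matrix (Fin n) (Fin m) ℂ) :=
  LinearMap.toContinuousLinearMap
    { toFun := fun D => (C * D).trace
      map_add' := fun D E => by rw [Matrix.mul_add, Matrix.trace_add]
      map_smul' := fun a D => by rw [Matrix.mul_smul, Matrix.trace_smul]; rfl }

/-- The trace norm of an `m × n` matrix: its norm as an element of the dual of the `n × m`
matrices with the operator norm, under the trace pairing. -/
noncomputable def traceNorm {m n : ℕ} (C : Matrix (Fin m) (Fin n) ℂ) : ℝ := ‖traceFunctional C‖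

lemma opNorm_nonneg {m n : ℕ} (A : Matrix (Fin m) (Fin n) ℂ) : 0 ≤ opNorm A := norm_nonneg A

lemma traceNorm_nonneg {m n : ℕ} (A : Matrix (Fin m) (Fin n) ℂ) : 0 ≤ traceNorm A :=
  norm_nonneg (traceFunctional A)

lemma norm_trace_mul_le {m n : ℕ} (C : Matrix (Fin m) (Fin n) ℂ)
    (D : Matrix (Fin n) (Fin m) ℂ) : ‖(C * D).trace‖ ≤ traceNorm C * opNorm D :=
  (traceFunctional C).le_opNorm D

lemma traceNorm_le {m n : ℕ} (C : Matrix (Fin m) (Fin n) ℂ) {r : ℝ} (hr : 0 ≤ r)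
    (h : ∀ D : Matrix (Fin n) (Fin m) ℂ, ‖(C * D).trace‖ ≤ r * opNorm D) : traceNorm C ≤ r :=
  ContinuousLinearMap.opNorm_le_bound _ hr h

lemma opNorm_mul_le {k m n : ℕ} (A : Matrix (Fin k) (Fin m) ℂ) (B : Matrix (Fin m) (Fin n) ℂ) :
    opNorm (A * B) ≤ opNorm A * opNorm B := Matrix.l2_opNorm_mul A B

lemma opNorm_one_le (n : ℕ) : opNorm (1 : Matrix (Fin n) (Fin n) ℂ) ≤ 1 := by
  unfold opNorm
  rw [← Matrix.diagonal_one, Matrix.l2_opNorm_diagonal]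
  refine (pi_norm_le_iff_of_nonneg zero_le_one).2 fun i => by simp

lemma opNorm_single_le {m n : ℕ} (i : Fin m) (j : Fin n) :
    opNorm (Matrix.single i j (1 : ℂ)) ≤ 1 := by
  have h := Matrix.l2_opNorm_conjTranspose_mul_self (Matrix.single i j (1 : ℂ))
  rw [Matrix.conjTranspose_single, Matrix.single_mul_single_same, star_one, mul_one,
    ← Matrix.diagonal_single, Matrix.l2_opNorm_diagonal, Pi.norm_single, norm_one] at h
  have h0 : 0 ≤ ‖Matrix.single i j (1 : ℂ)‖ := norm_nonneg _
  change ‖Matrix.single i j (1 : ℂ)‖ ≤ 1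
  nlinarith

lemma norm_entry_le_traceNorm {m n : ℕ} (C : Matrix (Fin m) (Fin n) ℂ) (i : Fin m) (j : Fin n) :
    ‖C i j‖ ≤ traceNorm C := by
  have h := norm_trace_mul_le C (Matrix.single j i (1 : ℂ))
  rw [Matrix.trace_mul_single, MulOpposite.op_one, one_smul] at h
  exact h.trans (mul_le_of_le_one_right (traceNorm_nonneg C) (opNorm_single_le j i))

lemma traceNorm_one_one_le : traceNorm (1 : Matrix (Fin 1) (Fin 1) ℂ) ≤ 1 := by
  refine traceNorm_le _ zero_le_one fun D => ?_
  have h : D = Matrix.diagonal (fun i => D i i) := by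
    ext i j; rw [Subsingleton.elim j i]; simp
  rw [one_mul, one_mul]
  unfold opNorm
  rw [h, Matrix.l2_opNorm_diagonal, Matrix.trace_diagonal, Fin.sum_univ_one]
  exact norm_le_pi_norm (fun i : Fin 1 => D i i) 0

lemma traceNorm_mul_mul_le {k m n l : ℕ} (A : Matrix (Fin k) (Fin m) ℂ)
    (C : Matrix (Fin m) (Fin n) ℂ) (B : Matrix (Fin n) (Fin l) ℂ) :
    traceNorm (A * C * B) ≤ opNorm A * traceNorm C * opNorm B := by
  have hA := opNorm_nonneg A
  have hB := opNorm_nonneg B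
  have hC := traceNorm_nonneg C
  refine traceNorm_le _ (by positivity) fun D => ?_
  have e : (A * C * B * D).trace = (C * (B * D * A)).trace := by
    rw [Matrix.mul_assoc, Matrix.mul_assoc, Matrix.trace_mul_comm, Matrix.mul_assoc]
  rw [e]
  refine (norm_trace_mul_le _ _).trans ?_
  have h1 : opNorm (B * D * A) ≤ opNorm B * opNorm D * opNorm A :=
    (opNorm_mul_le _ _).trans (mul_le_mul_of_nonneg_right (opNorm_mul_le _ _) hA)
  calc traceNorm C * opNorm (B * D * A) ≤ traceNorm C * (opNorm B * opNorm D * opNorm A) :=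
        mul_le_mul_of_nonneg_left h1 hC
    _ = _ := by ring

end Scalar

/-! ### Infima over finite decompositions -/

/-- The infimum of the total cost `∑ cost tₗ` over all finite decompositions `x = ∑ val tₗ`. -/
noncomputable def decompInf {T M : Type*} [AddCommMonoid M] (val : T → M) (cost : T → ℝ)
    (x : M) : ℝ :=
  sInf {r : ℝ | ∃ L : List T, x = (L.map val).sum ∧ r = (L.map cost).sum}

section DecompInf

variable {T M T' M' : Type*} [AddCommMonoid M] [AddCommMonoid M']
  {val : T → M} {cost : T → ℝ} {val' : T' → M'} {cost' : T' → ℝ}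

lemma cost_sum_nonneg (hc : ∀ t, 0 ≤ cost t) (L : List T) : 0 ≤ (L.map cost).sum :=
  List.sum_nonneg fun a ha => by
    obtain ⟨t, -, rfl⟩ := List.mem_map.1 ha
    exact hc t

lemma decompInf_nonneg (hc : ∀ t, 0 ≤ cost t) (x : M) : 0 ≤ decompInf val cost x :=
  Real.sInf_nonneg fun _ ⟨L, _, hr⟩ => hr ▸ cost_sum_nonneg hc L

lemma decompInf_le (hc : ∀ t, 0 ≤ cost t) (L : List T) :
    decompInf val cost (L.map val).sum ≤ (L.map cost).sum :=
  csInf_le ⟨0, fun _ ⟨L', _, hr⟩ => hr ▸ cost_sum_nonneg hc L'⟩ ⟨L, rfl, rfl⟩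

lemma decompInf_val_le (hc : ∀ t, 0 ≤ cost t) (t : T) : decompInf val cost (val t) ≤ cost t := by
  simpa using decompInf_le (val := val) hc [t]

lemma exists_decomp (h : AddSubmonoid.closure (Set.range val) = ⊤) (x : M) :
    ∃ L : List T, x = (L.map val).sum := by
  have hx : x ∈ AddSubmonoid.closure (Set.range val) := h ▸ AddSubmonoid.mem_top x
  induction hx using AddSubmonoid.closure_induction with
  | mem x hx => obtain ⟨t, rfl⟩ := hx; exact ⟨[t], by simp⟩
  | zero => exact ⟨[], by simp⟩
  | add x y _ _ hx hy =>
    obtain ⟨L, rfl⟩ := hx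
    obtain ⟨K, rfl⟩ := hy
    exact ⟨L ++ K, by simp⟩

lemma le_decompInf (h : AddSubmonoid.closure (Set.range val) = ⊤) {x : M} {s : ℝ}
    (hr : ∀ L : List T, x = (L.map val).sum → s ≤ (L.map cost).sum) :
    s ≤ decompInf val cost x := by
  obtain ⟨L, hL⟩ := exists_decomp h x
  exact le_csInf ⟨_, L, hL, rfl⟩ fun _ ⟨K, hK, hs⟩ => hs ▸ hr K hK

lemma decompInf_add_le (hc : ∀ t, 0 ≤ cost t) (h : AddSubmonoid.closure (Set.range val) = ⊤)
    (x y : M) : decompInf val cost (x + y) ≤ decompInf val cost x + decompInf val cost y := by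
  have key : ∀ L : List T, x = (L.map val).sum →
      decompInf val cost (x + y) - (L.map cost).sum ≤ decompInf val cost y := by
    intro L hL
    refine le_decompInf h fun K hK => ?_
    have := decompInf_le (val := val) hc (L ++ K)
    rw [List.map_append, List.sum_append, ← hL, ← hK, List.map_append, List.sum_append] at this
    linarith
  have : decompInf val cost (x + y) - decompInf val cost y ≤ decompInf val cost x :=
    le_decompInf h fun L hL => by linarith [key L hL]
  linarith

lemma decompInf_map_le (hc' : ∀ t, 0 ≤ cost' t)
    (h : AddSubmonoid.closure (Set.range val) = ⊤) (f : M →+ M') (g : T → T')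
    (hfg : ∀ t, f (val t) = val' (g t)) {r : ℝ} (hr : 0 ≤ r)
    (hcost : ∀ t, cost' (g t) ≤ r * cost t) (x : M) :
    decompInf val' cost' (f x) ≤ r * decompInf val cost x := by
  have key : ∀ L : List T, x = (L.map val).sum →
      decompInf val' cost' (f x) ≤ r * (L.map cost).sum := by
    intro L hL
    have e : f x = ((L.map g).map val').sum := by
      rw [hL, map_list_sum, List.map_map, List.map_map]
      congr 1
      exact List.map_congr_left fun t _ => hfg t
    rw [e]
    refine (decompInf_le hc' _).trans ?_
    rw [List.map_map, ← List.sum_map_mul_left]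
    exact List.sum_le_sum fun t _ => hcost t
  rcases hr.eq_or_lt with rfl | hr
  · obtain ⟨L, hL⟩ := exists_decomp h x
    simpa using key L hL
  · rw [mul_comm, ← div_le_iff₀ hr]
    refine le_decompInf h fun L hL => ?_
    rw [div_le_iff₀ hr, mul_comm]
    exact key L hL

lemma decompInf_smul_le {E : Type*} [AddCommGroup E] [Module ℂ E] {val : T → E}
    (hc : ∀ t, 0 ≤ cost t) (h : AddSubmonoid.closure (Set.range val) = ⊤) (a : ℂ) (g : T → T)
    (hg : ∀ t, a • val t = val (g t)) (hcost : ∀ t, cost (g t) ≤ ‖a‖ * cost t) (x : E) :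
    decompInf val cost (a • x) ≤ ‖a‖ * decompInf val cost x :=
  decompInf_map_le hc h (DistribSMul.toAddMonoidHom E a) g hg (norm_nonneg a) hcost x

lemma decompInf_zero (hc : ∀ t, 0 ≤ cost t) : decompInf val cost (0 : M) = 0 :=
  le_antisymm (by simpa using decompInf_le (val := val) hc []) (decompInf_nonneg hc 0)

end DecompInf

/-! ### Matrix-normed spaces -/

/-- The product `A B C` of a matrix `B` over a complex vector space with scalar matrices. -/
def matAct {V : Type*} [AddCommGroup V] [Module ℂ V] {k m n l : ℕ}
    (A : Matrix (Fin k) (Fin m) ℂ) (B : Matrix (Fin m) (Fin n) V)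
    (C : Matrix (Fin n) (Fin l) ℂ) : Matrix (Fin k) (Fin l) V :=
  Matrix.of fun i j => ∑ a, ∑ b, (A i a * C b j) • B a b

section MatAct

variable {V : Type*} [AddCommGroup V] [Module ℂ V] {k m n l : ℕ}

/-- The product `B ↦ A B C` as an additive map. -/
def matActHom (A : Matrix (Fin k) (Fin m) ℂ) (C : Matrix (Fin n) (Fin l) ℂ) :
    Matrix (Fin m) (Fin n) V →+ Matrix (Fin k) (Fin l) V where
  toFun B := matAct A B C
  map_zero' := by ext i j; simp [matAct]
  map_add' B B' := by
    ext i j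
    simp [matAct, Finset.sum_add_distrib]

lemma matAct_single (i : Fin m) (j : Fin n) (A : Matrix (Fin 1) (Fin 1) V) :
    matAct (Matrix.single i 0 1) A (Matrix.single 0 j 1) = Matrix.single i j (A 0 0) := by
  ext i' j'
  simp only [matAct, Fin.sum_univ_one, Matrix.single_apply]
  by_cases h1 : i = i' <;> by_cases h2 : j = j' <;> simp [h1, h2]

lemma matAct_entry (A : Matrix (Fin m) (Fin n) V) (i : Fin m) (j : Fin n) :
    matAct (Matrix.single 0 i 1) A (Matrix.single j 0 1) = Matrix.of fun (_ _ : Fin 1) => A i j := by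
  ext i' j'
  have hi := Subsingleton.elim 0 i'
  have hj := Subsingleton.elim 0 j'
  subst hi hj
  simp [matAct, Matrix.single_apply]

end MatAct

/-- A matrix-norm on a complex vector space `V` whose `(1,1)`-level is the given norm of `V`.
`V` is allowed to be only seminormed, so that completions of matrix-seminormed spaces can be
formed. If `V` is normed, then every level is a norm, see `matNorm_eq_zero_iff`. -/
class MatrixNormedSpace (V : Type*) [SeminormedAddCommGroup V] [NormedSpace ℂ V] where
  /-- the norm on `m × n` matrices over `V` -/
  matNorm : ∀ {m n : ℕ}, Matrix (Fin m) (Fin n) V → ℝ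
  matNorm_add_le : ∀ {m n : ℕ} (A B : Matrix (Fin m) (Fin n) V),
    matNorm (A + B) ≤ matNorm A + matNorm B
  matNorm_smul : ∀ {m n : ℕ} (a : ℂ) (A : Matrix (Fin m) (Fin n) V),
    matNorm (a • A) = ‖a‖ * matNorm A
  matNorm_matAct_le : ∀ {k m n l : ℕ} (A : Matrix (Fin k) (Fin m) ℂ)
    (B : Matrix (Fin m) (Fin n) V) (C : Matrix (Fin n) (Fin l) ℂ),
    matNorm (matAct A B C) ≤ opNorm A * matNorm B * opNorm C
  matNorm_one_one : ∀ A : Matrix (Fin 1) (Fin 1) V, matNorm A = ‖A 0 0‖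

section Basic

variable {V : Type*} [SeminormedAddCommGroup V] [NormedSpace ℂ V] [MatrixNormedSpace V]
  {m n : ℕ}

lemma matNorm_zero : MatrixNormedSpace.matNorm (0 : Matrix (Fin m) (Fin n) V) = 0 := by
  have := MatrixNormedSpace.matNorm_smul (0 : ℂ) (0 : Matrix (Fin m) (Fin n) V)
  simpa using this

lemma matNorm_neg (A : Matrix (Fin m) (Fin n) V) :
    MatrixNormedSpace.matNorm (-A) = MatrixNormedSpace.matNorm A := by
  have := MatrixNormedSpace.matNorm_smul (-1 : ℂ) A
  simpa using this

lemma matNorm_nonneg (A : Matrix (Fin m) (Fin n) V) : 0 ≤ MatrixNormedSpace.matNorm A := by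
  have h := MatrixNormedSpace.matNorm_add_le A (-A)
  rw [add_neg_cancel, matNorm_zero, matNorm_neg] at h
  linarith

lemma norm_entry_le_matNorm (A : Matrix (Fin m) (Fin n) V) (i : Fin m) (j : Fin n) :
    ‖A i j‖ ≤ MatrixNormedSpace.matNorm A := by
  have h := MatrixNormedSpace.matNorm_matAct_le (Matrix.single (0 : Fin 1) i 1) A
    (Matrix.single j (0 : Fin 1) 1)
  rw [matAct_entry, MatrixNormedSpace.matNorm_one_one, Matrix.of_apply] at h
  refine h.trans ?_
  have h1 := opNorm_single_le (0 : Fin 1) i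
  have h2 := opNorm_single_le j (0 : Fin 1)
  have h0 := matNorm_nonneg A
  exact (mul_le_of_le_one_right (mul_nonneg (opNorm_nonneg _) h0) h2).trans
    (mul_le_of_le_one_left h0 h1)

lemma matNorm_single_le (i : Fin m) (j : Fin n) (v : V) :
    MatrixNormedSpace.matNorm (Matrix.single i j v) ≤ ‖v‖ := by
  have h := MatrixNormedSpace.matNorm_matAct_le (Matrix.single i (0 : Fin 1) 1)
    (Matrix.of fun _ _ => v) (Matrix.single (0 : Fin 1) j 1)
  rw [matAct_single, MatrixNormedSpace.matNorm_one_one, Matrix.of_apply] at h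
  refine h.trans ?_
  exact (mul_le_of_le_one_right (mul_nonneg (opNorm_nonneg _) (norm_nonneg _))
    (opNorm_single_le _ _)).trans (mul_le_of_le_one_left (norm_nonneg _) (opNorm_single_le _ _))

lemma matNorm_sum_le {ι : Type*} (s : Finset ι) (f : ι → Matrix (Fin m) (Fin n) V) :
    MatrixNormedSpace.matNorm (∑ i ∈ s, f i) ≤ ∑ i ∈ s, MatrixNormedSpace.matNorm (f i) :=
  Finset.le_sum_of_subadditive _ matNorm_zero.le MatrixNormedSpace.matNorm_add_le s f

lemma matNorm_le_sum (A : Matrix (Fin m) (Fin n) V) :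
    MatrixNormedSpace.matNorm A ≤ ∑ i, ∑ j, ‖A i j‖ := by
  conv_lhs => rw [Matrix.matrix_eq_sum_single A]
  refine (matNorm_sum_le _ _).trans (Finset.sum_le_sum fun i _ => ?_)
  exact (matNorm_sum_le _ _).trans (Finset.sum_le_sum fun j _ => matNorm_single_le _ _ _)

lemma abs_matNorm_sub_le (A B : Matrix (Fin m) (Fin n) V) :
    |MatrixNormedSpace.matNorm A - MatrixNormedSpace.matNorm B| ≤ ∑ i, ∑ j, ‖A i j - B i j‖ := by
  have h1 := MatrixNormedSpace.matNorm_add_le (A - B) B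
  have h2 := MatrixNormedSpace.matNorm_add_le (-(A - B)) A
  rw [matNorm_neg] at h2
  have e1 : A - B + B = A := by abel
  have e2 : -(A - B) + A = B := by abel
  rw [e1] at h1
  rw [e2] at h2
  have h3 := matNorm_le_sum (A - B)
  simp only [Matrix.sub_apply] at h3
  rw [abs_le]
  constructor <;> linarith

lemma uniformContinuous_matNorm :
    UniformContinuous (MatrixNormedSpace.matNorm : Matrix (Fin m) (Fin n) V → ℝ) := by
  unfold UniformContinuous
  rw [Metric.uniformity_eq_comap_nhds_zero (α := ℝ), Filter.tendsto_comap_iff]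
  refine squeeze_zero (fun _ => dist_nonneg) (fun p => abs_matNorm_sub_le p.1 p.2) ?_
  have h0 : (0 : ℝ) = ∑ _i : Fin m, ∑ _j : Fin n, 0 := by simp
  rw [h0]
  refine tendsto_finsetSum _ fun i _ => tendsto_finsetSum _ fun j _ => ?_
  have h : UniformContinuous fun A : Matrix (Fin m) (Fin n) V => A i j :=
    (Pi.uniformContinuous_proj (fun _ : Fin n => V) j).comp
      (Pi.uniformContinuous_proj (fun _ : Fin m => Fin n → V) i)
  unfold UniformContinuous at h
  rw [Metric.uniformity_eq_comap_nhds_zero (α := V), Filter.tendsto_comap_iff] at h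
  simpa only [Function.comp_def, dist_eq_norm] using h

lemma matNorm_left_le {k : ℕ} (A : Matrix (Fin k) (Fin m) ℂ) (B : Matrix (Fin m) (Fin n) V) :
    MatrixNormedSpace.matNorm (matAct A B (1 : Matrix (Fin n) (Fin n) ℂ)) ≤ opNorm A * MatrixNormedSpace.matNorm B :=
  (MatrixNormedSpace.matNorm_matAct_le A B (1 : Matrix (Fin n) (Fin n) ℂ)).trans
    (mul_le_of_le_one_right (mul_nonneg (opNorm_nonneg _) (matNorm_nonneg _)) (opNorm_one_le _))

lemma matNorm_right_le {l : ℕ} (B : Matrix (Fin m) (Fin n) V) (C : Matrix (Fin n) (Fin l) ℂ) :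
    MatrixNormedSpace.matNorm (matAct (1 : Matrix (Fin m) (Fin m) ℂ) B C) ≤ MatrixNormedSpace.matNorm B * opNorm C :=
  (MatrixNormedSpace.matNorm_matAct_le (1 : Matrix (Fin m) (Fin m) ℂ) B C).trans
    (mul_le_mul_of_nonneg_right (mul_le_of_le_one_left (matNorm_nonneg _) (opNorm_one_le _))
      (opNorm_nonneg _))

end Basic

/-- In a matrix-normed space which is a normed space, all levels are norms. -/
lemma matNorm_eq_zero_iff {V : Type*} [NormedAddCommGroup V] [NormedSpace ℂ V]
    [MatrixNormedSpace V] {m n : ℕ} (A : Matrix (Fin m) (Fin n) V) :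
    MatrixNormedSpace.matNorm A = 0 ↔ A = 0 := by
  constructor
  · intro h
    ext i j
    exact norm_le_zero_iff.1 (h ▸ norm_entry_le_matNorm A i j)
  · rintro rfl
    exact matNorm_zero

/-- A linear map `φ` is completely contractive if all its ampliations, which apply `φ` to each
entry of a matrix, are contractive. -/
def CompletelyContractive {V W : Type*} [SeminormedAddCommGroup V] [NormedSpace ℂ V]
    [MatrixNormedSpace V] [SeminormedAddCommGroup W] [NormedSpace ℂ W] [MatrixNormedSpace W]
    (φ : V →ₗ[ℂ] W) : Prop :=
  ∀ (m n : ℕ) (A : Matrix (Fin m) (Fin n) V),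
    MatrixNormedSpace.matNorm (A.map φ) ≤ MatrixNormedSpace.matNorm A

/-! ### Completion of a matrix-normed space -/

section MatrixCompletion

open UniformSpace

variable {V : Type*} [SeminormedAddCommGroup V] {m n : ℕ}

/-- The canonical map from matrices over `V` to matrices over the completion of `V`. -/
def toComplMatrix (B : Matrix (Fin m) (Fin n) V) : Matrix (Fin m) (Fin n) (Completion V) :=
  B.map fun v => (v : Completion V)

lemma isUniformInducing_toComplMatrix :
    IsUniformInducing (toComplMatrix : Matrix (Fin m) (Fin n) V → _) := by
  have h : Isometry (Pi.map (fun _ : Fin m => Pi.map (fun _ : Fin n =>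
      ((↑) : V → Completion V)))) :=
    Isometry.piMap _ fun _ => Isometry.piMap _ fun _ => Completion.coe_isometry
  exact h.isUniformInducing

lemma denseRange_toComplMatrix :
    DenseRange (toComplMatrix : Matrix (Fin m) (Fin n) V → _) := by
  have h : DenseRange (Pi.map (fun _ : Fin m => Pi.map (fun _ : Fin n =>
      ((↑) : V → Completion V)))) :=
    DenseRange.piMap fun _ => DenseRange.piMap fun _ => Completion.denseRange_coe
  exact h

lemma isDenseInducing_toComplMatrix :
    IsDenseInducing (toComplMatrix : Matrix (Fin m) (Fin n) V → _) :=
  isUniformInducing_toComplMatrix.isDenseInducing denseRange_toComplMatrix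

variable [NormedSpace ℂ V]

lemma matAct_toComplMatrix {k l : ℕ} (A : Matrix (Fin k) (Fin m) ℂ)
    (B : Matrix (Fin m) (Fin n) V) (C : Matrix (Fin n) (Fin l) ℂ) :
    matAct A (toComplMatrix B) C = toComplMatrix (matAct A B C) := by
  ext i j
  simp only [matAct, toComplMatrix, Matrix.of_apply, Matrix.map_apply]
  have h (x : V) : (x : Completion V) = (Completion.toComplₗᵢ (𝕜 := ℂ) (E := V)) x := rfl
  simp only [h, map_sum, map_smul]

variable [MatrixNormedSpace V]

/-- The norm of a matrix `A` over the completion of `V`: the limit of the norms of the matrices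
over `V`, as their images in the matrices over the completion tend to `A`. -/
noncomputable def complMatNorm (A : Matrix (Fin m) (Fin n) (Completion V)) : ℝ :=
  isDenseInducing_toComplMatrix.extend
    (MatrixNormedSpace.matNorm : Matrix (Fin m) (Fin n) V → ℝ) A

lemma continuous_complMatNorm :
    Continuous (complMatNorm : Matrix (Fin m) (Fin n) (Completion V) → ℝ) :=
  (uniformContinuous_uniformly_extend isUniformInducing_toComplMatrix denseRange_toComplMatrix
    uniformContinuous_matNorm).continuous

lemma complMatNorm_toComplMatrix (B : Matrix (Fin m) (Fin n) V) :
    complMatNorm (toComplMatrix B) = MatrixNormedSpace.matNorm B :=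
  isDenseInducing_toComplMatrix.extend_eq uniformContinuous_matNorm.continuous B

/-- The completion of a matrix-normed space. -/
noncomputable instance : MatrixNormedSpace (Completion V) where
  matNorm := complMatNorm
  matNorm_add_le {m n} A B := by
    refine denseRange_toComplMatrix.induction_on₂
      (p := fun A B => complMatNorm (A + B) ≤ complMatNorm A + complMatNorm B) ?_ ?_ A B
    · exact isClosed_le (continuous_complMatNorm.comp (continuous_fst.add continuous_snd))
        ((continuous_complMatNorm.comp continuous_fst).add
          (continuous_complMatNorm.comp continuous_snd))
    · intro A B
      have e : toComplMatrix A + toComplMatrix B = toComplMatrix (A + B) := by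
        ext i j; exact (Completion.coe_add _ _).symm
      simp only [e, complMatNorm_toComplMatrix]
      exact MatrixNormedSpace.matNorm_add_le A B
  matNorm_smul {m n} a A := by
    refine denseRange_toComplMatrix.induction_on
      (p := fun A => complMatNorm (a • A) = ‖a‖ * complMatNorm A) A ?_ ?_
    · exact isClosed_eq (continuous_complMatNorm.comp (continuous_id.const_smul a))
        (continuous_const.mul continuous_complMatNorm)
    · intro A
      have e : a • toComplMatrix A = toComplMatrix (a • A) := by
        ext i j; exact (Completion.coe_smul _ _).symm
      simp only [e, complMatNorm_toComplMatrix]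
      exact MatrixNormedSpace.matNorm_smul a A
  matNorm_matAct_le {k m n l} A B C := by
    refine denseRange_toComplMatrix.induction_on
      (p := fun B => complMatNorm (matAct A B C) ≤ opNorm A * complMatNorm B * opNorm C) B ?_ ?_
    · refine isClosed_le (continuous_complMatNorm.comp ?_)
        ((continuous_const.mul continuous_complMatNorm).mul continuous_const)
      refine continuous_matrix fun i j => ?_
      simp only [matAct, Matrix.of_apply]
      refine continuous_finsetSum _ fun a _ => continuous_finsetSum _ fun b _ => ?_
      have h : Continuous fun B : Matrix (Fin m) (Fin n) (Completion V) => B a b :=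
        continuous_id.matrix_elem a b
      exact h.const_smul (A i a * C b j)
    · intro B
      rw [matAct_toComplMatrix, complMatNorm_toComplMatrix, complMatNorm_toComplMatrix]
      exact MatrixNormedSpace.matNorm_matAct_le A B C
  matNorm_one_one A := by
    refine denseRange_toComplMatrix.induction_on
      (p := fun A => complMatNorm A = ‖A 0 0‖) A ?_ ?_
    · exact isClosed_eq continuous_complMatNorm (continuous_id.matrix_elem 0 0).norm
    · intro A
      rw [complMatNorm_toComplMatrix, MatrixNormedSpace.matNorm_one_one]
      exact (Completion.norm_coe _).symm

end MatrixCompletion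

/-! ### The absolute maximal matrix-norm -/

/-- The space `V`, to be equipped with its absolute maximal matrix-norm. -/
def AMAX (V : Type*) : Type _ := V

section AMAX

instance (V : Type*) [NormedAddCommGroup V] : NormedAddCommGroup (AMAX V) :=
  inferInstanceAs (NormedAddCommGroup V)

instance (V : Type*) [NormedAddCommGroup V] [NormedSpace ℂ V] : NormedSpace ℂ (AMAX V) :=
  inferInstanceAs (NormedSpace ℂ V)

instance (V : Type*) [NormedAddCommGroup V] [CompleteSpace V] : CompleteSpace (AMAX V) :=
  inferInstanceAs (CompleteSpace V)

/-- The matrix `v ⊗ C` with entries `C i j • v`. -/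
def vecTensor {V : Type*} [AddCommGroup V] [Module ℂ V] {m n : ℕ}
    (t : V × Matrix (Fin m) (Fin n) ℂ) : Matrix (Fin m) (Fin n) V :=
  Matrix.of fun i j => t.2 i j • t.1

/-- The projective tensor norm of a matrix `A` over `V`, where the scalar matrices carry the trace
norm: the infimum of `∑ ‖vₗ‖ ‖Cₗ‖` over all decompositions `A = ∑ vₗ ⊗ Cₗ`. -/
noncomputable def amaxNorm {V : Type*} [NormedAddCommGroup V] [NormedSpace ℂ V] {m n : ℕ}
    (A : Matrix (Fin m) (Fin n) V) : ℝ :=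
  decompInf vecTensor (fun t : V × Matrix (Fin m) (Fin n) ℂ => ‖t.1‖ * traceNorm t.2) A

variable {V : Type*} [NormedAddCommGroup V] [NormedSpace ℂ V] {m n : ℕ}

lemma closure_of_single {E T : Type*} [AddCommGroup E] (val : T → Matrix (Fin m) (Fin n) E)
    (h : ∀ i j e, Matrix.single i j e ∈ AddSubmonoid.closure (Set.range val)) :
    AddSubmonoid.closure (Set.range val) = ⊤ := by
  refine (AddSubmonoid.eq_top_iff' _).2 fun A => ?_
  rw [Matrix.matrix_eq_sum_single A]
  exact sum_mem fun i _ => sum_mem fun j _ => h i j _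

lemma closure_vecTensor : AddSubmonoid.closure
    (Set.range (vecTensor : V × Matrix (Fin m) (Fin n) ℂ → _)) = ⊤ := by
  refine closure_of_single _ fun i j v =>
    AddSubmonoid.subset_closure ⟨(v, Matrix.single i j 1), ?_⟩
  ext i' j'
  simp [vecTensor, Matrix.single_apply]

lemma amax_cost_nonneg {V : Type*} [NormedAddCommGroup V] {m n : ℕ}
    (t : V × Matrix (Fin m) (Fin n) ℂ) : 0 ≤ ‖t.1‖ * traceNorm t.2 :=
  mul_nonneg (norm_nonneg _) (traceNorm_nonneg _)

lemma eq_mul_of_smul_le {E : Type*} [AddCommGroup E] [Module ℂ E] (N : E → ℝ) (h0 : N 0 = 0)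
    (h : ∀ (a : ℂ) x, N (a • x) ≤ ‖a‖ * N x) (a : ℂ) (x : E) : N (a • x) = ‖a‖ * N x := by
  refine le_antisymm (h a x) ?_
  by_cases ha : a = 0
  · subst ha; simp [h0]
  · have := h a⁻¹ (a • x)
    rw [smul_smul, inv_mul_cancel₀ ha, one_smul, norm_inv] at this
    have hpos : 0 < ‖a‖ := norm_pos_iff.2 ha
    rwa [← div_eq_inv_mul, le_div_iff₀ hpos, mul_comm] at this

lemma matAct_vecTensor {k l : ℕ} (A : Matrix (Fin k) (Fin m) ℂ) (C : Matrix (Fin n) (Fin l) ℂ)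
    (t : V × Matrix (Fin m) (Fin n) ℂ) :
    matAct A (vecTensor t) C = vecTensor (t.1, A * t.2 * C) := by
  ext i j
  simp only [matAct, vecTensor, Matrix.of_apply, smul_smul, Matrix.mul_apply, Finset.sum_mul,
    Finset.sum_smul]
  rw [Finset.sum_comm]
  refine Finset.sum_congr rfl fun a _ => Finset.sum_congr rfl fun b _ => ?_
  congr 1
  ring

lemma amaxNorm_add_le (A B : Matrix (Fin m) (Fin n) V) :
    amaxNorm (A + B) ≤ amaxNorm A + amaxNorm B :=
  decompInf_add_le amax_cost_nonneg closure_vecTensor A B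

lemma amaxNorm_zero : amaxNorm (0 : Matrix (Fin m) (Fin n) V) = 0 :=
  decompInf_zero amax_cost_nonneg

lemma amaxNorm_smul_le (a : ℂ) (A : Matrix (Fin m) (Fin n) V) :
    amaxNorm (a • A) ≤ ‖a‖ * amaxNorm A := by
  refine decompInf_smul_le amax_cost_nonneg closure_vecTensor a (fun t => (a • t.1, t.2))
    (fun t => ?_) (fun t => ?_) A
  · ext i j
    simp only [vecTensor, Matrix.smul_apply, Matrix.of_apply]
    exact smul_comm a (t.2 i j) t.1
  · rw [norm_smul, mul_assoc]

lemma amaxNorm_matAct_le {k l : ℕ} (A : Matrix (Fin k) (Fin m) ℂ) (B : Matrix (Fin m) (Fin n) V)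
    (C : Matrix (Fin n) (Fin l) ℂ) :
    amaxNorm (matAct A B C) ≤ opNorm A * amaxNorm B * opNorm C := by
  have h := decompInf_map_le (val := (vecTensor : V × _ → _)) (val' := vecTensor)
    (cost := fun t => ‖t.1‖ * traceNorm t.2) (cost' := fun t => ‖t.1‖ * traceNorm t.2)
    amax_cost_nonneg closure_vecTensor
    (matActHom A C) (fun t => (t.1, A * t.2 * C)) (matAct_vecTensor A C)
    (mul_nonneg (opNorm_nonneg A) (opNorm_nonneg C)) (fun t => ?_) B
  · exact h.trans (le_of_eq (mul_right_comm _ _ _))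
  · calc ‖t.1‖ * traceNorm (A * t.2 * C)
        ≤ ‖t.1‖ * (opNorm A * traceNorm t.2 * opNorm C) :=
          mul_le_mul_of_nonneg_left (traceNorm_mul_mul_le _ _ _) (norm_nonneg _)
      _ = _ := by ring

lemma amaxNorm_one_one (A : Matrix (Fin 1) (Fin 1) V) : amaxNorm A = ‖A 0 0‖ := by
  refine le_antisymm ?_ ?_
  · have e : vecTensor (A 0 0, (1 : Matrix (Fin 1) (Fin 1) ℂ)) = A := by
      ext i j
      rw [Subsingleton.elim i 0, Subsingleton.elim j 0]
      exact one_smul ℂ (A 0 0)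
    have h := decompInf_val_le (val := vecTensor (V := V)) amax_cost_nonneg
      (A 0 0, (1 : Matrix (Fin 1) (Fin 1) ℂ))
    rw [e] at h
    exact h.trans (mul_le_of_le_one_right (norm_nonneg _) traceNorm_one_one_le)
  · refine le_decompInf closure_vecTensor fun L hL => ?_
    rw [hL]
    clear hL
    induction L with
    | nil => simp
    | cons t L ih =>
      rw [List.map_cons, List.sum_cons, List.map_cons, List.sum_cons]
      refine (norm_add_le (vecTensor t 0 0) _).trans (add_le_add ?_ ih)
      change ‖t.2 0 0 • t.1‖ ≤ _
      rw [norm_smul, mul_comm]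
      exact mul_le_mul_of_nonneg_left (norm_entry_le_traceNorm _ _ _) (norm_nonneg _)

/-- The absolute maximal matrix-norm. -/
noncomputable instance : MatrixNormedSpace (AMAX V) where
  matNorm A := amaxNorm (V := V) A
  matNorm_add_le := amaxNorm_add_le (V := V)
  matNorm_smul := eq_mul_of_smul_le _ (amaxNorm_zero (V := V)) (amaxNorm_smul_le (V := V))
  matNorm_matAct_le := amaxNorm_matAct_le (V := V)
  matNorm_one_one := amaxNorm_one_one (V := V)

end AMAX

/-! ### The projective tensor product of Banach spaces -/

/-- The algebraic tensor product, to be equipped with the projective tensor norm. -/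
def ProjTensorAlg (V W : Type*) [NormedAddCommGroup V] [NormedSpace ℂ V] [NormedAddCommGroup W]
    [NormedSpace ℂ W] : Type _ := V ⊗[ℂ] W

section Projective

variable (V W : Type*) [NormedAddCommGroup V] [NormedSpace ℂ V] [NormedAddCommGroup W]
  [NormedSpace ℂ W]

noncomputable instance : AddCommGroup (ProjTensorAlg V W) :=
  inferInstanceAs (AddCommGroup (V ⊗[ℂ] W))

noncomputable instance : Module ℂ (ProjTensorAlg V W) :=
  inferInstanceAs (Module ℂ (V ⊗[ℂ] W))

variable {V W}

/-- The elementary tensor `v ⊗ w`. -/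
def projTmul (t : V × W) : ProjTensorAlg V W := t.1 ⊗ₜ[ℂ] t.2

/-- The projective tensor norm: the infimum of `∑ ‖vₗ‖ ‖wₗ‖` over all decompositions
`x = ∑ vₗ ⊗ wₗ`. -/
noncomputable def projNorm (x : ProjTensorAlg V W) : ℝ :=
  decompInf projTmul (fun t : V × W => ‖t.1‖ * ‖t.2‖) x

lemma closure_projTmul : AddSubmonoid.closure (Set.range (projTmul : V × W → _)) = ⊤ := by
  refine (AddSubmonoid.eq_top_iff' _).2 fun x => ?_
  induction x using TensorProduct.induction_on with
  | zero => exact zero_mem _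
  | tmul v w => exact AddSubmonoid.subset_closure ⟨(v, w), rfl⟩
  | add x y hx hy => exact add_mem hx hy

lemma proj_cost_nonneg {V W : Type*} [NormedAddCommGroup V] [NormedAddCommGroup W] (t : V × W) : 0 ≤ ‖t.1‖ * ‖t.2‖ := by positivity

lemma projNorm_smul_le (a : ℂ) (x : ProjTensorAlg V W) : projNorm (a • x) ≤ ‖a‖ * projNorm x :=
  decompInf_smul_le proj_cost_nonneg closure_projTmul a (fun t => (a • t.1, t.2))
    (fun _ => rfl) (fun t => by rw [norm_smul, mul_assoc]) x

/-- The projective tensor norm as a seminorm. -/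
noncomputable def projSeminorm : Seminorm ℂ (ProjTensorAlg V W) :=
  .ofSMulLE projNorm (decompInf_zero proj_cost_nonneg)
    (decompInf_add_le proj_cost_nonneg closure_projTmul) projNorm_smul_le

noncomputable instance : SeminormedAddCommGroup (ProjTensorAlg V W) :=
  AddGroupSeminorm.toSeminormedAddCommGroup projSeminorm.toAddGroupSeminorm

noncomputable instance : NormedSpace ℂ (ProjTensorAlg V W) where
  norm_smul_le := projNorm_smul_le

end Projective

/-- The projective tensor product of `V` and `W`: the completion of the algebraic tensor product
for the projective tensor norm. -/
abbrev ProjTensor (V W : Type*) [NormedAddCommGroup V] [NormedSpace ℂ V] [NormedAddCommGroup W]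
    [NormedSpace ℂ W] : Type _ := UniformSpace.Completion (ProjTensorAlg V W)

/-! ### The Haagerup tensor product of matrix-normed spaces -/

/-- The algebraic tensor product, to be equipped with the Haagerup matrix-norm. -/
def HaagerupAlg (V W : Type*) [NormedAddCommGroup V] [NormedSpace ℂ V] [MatrixNormedSpace V]
    [NormedAddCommGroup W] [NormedSpace ℂ W] [MatrixNormedSpace W] : Type _ := V ⊗[ℂ] W

section Haagerup

variable (V W : Type*) [NormedAddCommGroup V] [NormedSpace ℂ V] [MatrixNormedSpace V]
  [NormedAddCommGroup W] [NormedSpace ℂ W] [MatrixNormedSpace W]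

noncomputable instance : AddCommGroup (HaagerupAlg V W) :=
  inferInstanceAs (AddCommGroup (V ⊗[ℂ] W))

noncomputable instance : Module ℂ (HaagerupAlg V W) :=
  inferInstanceAs (Module ℂ (V ⊗[ℂ] W))

/-- Pairs `(A, B)` of an `m × q` matrix over `V` and a `q × n` matrix over `W`, for any `q`. -/
abbrev MatPair (m n : ℕ) : Type _ :=
  Σ q : ℕ, Matrix (Fin m) (Fin q) V × Matrix (Fin q) (Fin n) W

variable {V W} {m n : ℕ}

/-- The tensor matrix product `A ⊙ B`, with `(i, k)`-entry `∑ j, A i j ⊗ B j k`. -/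
noncomputable def odot (t : MatPair V W m n) : Matrix (Fin m) (Fin n) (HaagerupAlg V W) :=
  Matrix.of fun i k => ∑ j, (t.2.1 i j ⊗ₜ[ℂ] t.2.2 j k : V ⊗[ℂ] W)

/-- The product `‖A‖ ‖B‖` of the matrix-norms. -/
noncomputable def pairCost (t : MatPair V W m n) : ℝ :=
  MatrixNormedSpace.matNorm t.2.1 * MatrixNormedSpace.matNorm t.2.2

/-- The Haagerup matrix-norm: the infimum of `∑ ‖Aₗ‖ ‖Bₗ‖` over all decompositions
`C = ∑ Aₗ ⊙ Bₗ`. -/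
noncomputable def haagerupNorm (C : Matrix (Fin m) (Fin n) (HaagerupAlg V W)) : ℝ :=
  decompInf odot pairCost C

lemma pairCost_nonneg (t : MatPair V W m n) : 0 ≤ pairCost t :=
  mul_nonneg (matNorm_nonneg _) (matNorm_nonneg _)

lemma closure_odot : AddSubmonoid.closure (Set.range (odot : MatPair V W m n → _)) = ⊤ := by
  refine closure_of_single _ fun i k x => ?_
  induction x using TensorProduct.induction_on with
  | zero =>
    have e : Matrix.single i k (0 : HaagerupAlg V W) = 0 := Matrix.single_zero i k
    exact e ▸ zero_mem _
  | tmul v w =>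
    refine AddSubmonoid.subset_closure
      ⟨⟨1, Matrix.single i 0 v, Matrix.single 0 k w⟩, ?_⟩
    ext i' k'
    change (∑ j : Fin 1, (Matrix.single i 0 v i' j ⊗ₜ[ℂ] Matrix.single 0 k w j k' : V ⊗[ℂ] W)) =
      (Matrix.single i k (v ⊗ₜ[ℂ] w) : Matrix _ _ (V ⊗[ℂ] W)) i' k'
    simp only [Fin.sum_univ_one, Matrix.single_apply]
    by_cases h1 : i = i' <;> by_cases h2 : k = k' <;> simp [h1, h2]
  | add x y hx hy =>
    have e := Matrix.single_add i k (x : HaagerupAlg V W) y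
    exact e ▸ add_mem hx hy

lemma haagerupNorm_add_le (A B : Matrix (Fin m) (Fin n) (HaagerupAlg V W)) :
    haagerupNorm (A + B) ≤ haagerupNorm A + haagerupNorm B :=
  decompInf_add_le pairCost_nonneg closure_odot A B

lemma haagerupNorm_smul_le (a : ℂ) (A : Matrix (Fin m) (Fin n) (HaagerupAlg V W)) :
    haagerupNorm (a • A) ≤ ‖a‖ * haagerupNorm A := by
  refine decompInf_smul_le pairCost_nonneg closure_odot a
    (fun t => ⟨t.1, a • t.2.1, t.2.2⟩) (fun t => ?_) (fun t => ?_) A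
  · ext i k
    change a • (∑ j, (t.2.1 i j ⊗ₜ[ℂ] t.2.2 j k : V ⊗[ℂ] W)) =
      ∑ j, ((a • t.2.1 i j) ⊗ₜ[ℂ] t.2.2 j k : V ⊗[ℂ] W)
    rw [Finset.smul_sum]
    rfl
  · simp only [pairCost, MatrixNormedSpace.matNorm_smul, mul_assoc, le_refl]

lemma haagerupNorm_zero : haagerupNorm (0 : Matrix (Fin m) (Fin n) (HaagerupAlg V W)) = 0 :=
  decompInf_zero pairCost_nonneg

lemma matAct_odot {k l : ℕ} (A : Matrix (Fin k) (Fin m) ℂ) (C : Matrix (Fin n) (Fin l) ℂ)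
    (t : MatPair V W m n) :
    matAct A (odot t) C = odot ⟨t.1, matAct A t.2.1 1, matAct 1 t.2.2 C⟩ := by
  ext i j
  change (∑ a, ∑ b, (A i a * C b j) • ∑ c, (t.2.1 a c ⊗ₜ[ℂ] t.2.2 c b : V ⊗[ℂ] W)) =
    ∑ c, (matAct A t.2.1 1 i c ⊗ₜ[ℂ] matAct 1 t.2.2 C c j : V ⊗[ℂ] W)
  have h1 (c) : matAct A t.2.1 1 i c = ∑ a, A i a • t.2.1 a c := by
    simp [matAct, Matrix.one_apply]
  have h2 (c) : matAct 1 t.2.2 C c j = ∑ b, C b j • t.2.2 c b := by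
    simp [matAct, Matrix.one_apply]
  simp only [h1, h2, TensorProduct.sum_tmul, TensorProduct.tmul_sum, Finset.smul_sum,
    TensorProduct.smul_tmul_smul]
  refine ((Finset.sum_congr rfl fun a _ => Finset.sum_comm).trans Finset.sum_comm).trans ?_
  refine Finset.sum_congr rfl fun c _ => ?_
  first
  | rfl
  | exact Finset.sum_comm

lemma haagerupNorm_matAct_le {k l : ℕ} (A : Matrix (Fin k) (Fin m) ℂ)
    (B : Matrix (Fin m) (Fin n) (HaagerupAlg V W)) (C : Matrix (Fin n) (Fin l) ℂ) :
    haagerupNorm (matAct A B C) ≤ opNorm A * haagerupNorm B * opNorm C := by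
  have h := decompInf_map_le (val := (odot : MatPair V W m n → _)) (val' := odot)
    (cost := pairCost) (cost' := pairCost) pairCost_nonneg closure_odot (matActHom A C)
    (fun t => ⟨t.1, matAct A t.2.1 1, matAct 1 t.2.2 C⟩) (matAct_odot A C)
    (mul_nonneg (opNorm_nonneg A) (opNorm_nonneg C)) (fun t => ?_) B
  · exact h.trans (le_of_eq (mul_right_comm _ _ _))
  · calc _ ≤ (opNorm A * MatrixNormedSpace.matNorm t.2.1) *
          (MatrixNormedSpace.matNorm t.2.2 * opNorm C) :=
          mul_le_mul (matNorm_left_le _ _) (matNorm_right_le _ _) (matNorm_nonneg _)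
            (mul_nonneg (opNorm_nonneg _) (matNorm_nonneg _))
      _ = _ := by unfold pairCost; ring

/-- The `(1,1)`-level of the Haagerup matrix-norm. -/
noncomputable def haagerupSeminorm : Seminorm ℂ (HaagerupAlg V W) :=
  .ofSMulLE (fun x => haagerupNorm (Matrix.of fun (_ _ : Fin 1) => x))
    haagerupNorm_zero (fun _ _ => haagerupNorm_add_le _ _) (fun a _ => haagerupNorm_smul_le a _)

noncomputable instance : SeminormedAddCommGroup (HaagerupAlg V W) :=
  AddGroupSeminorm.toSeminormedAddCommGroup haagerupSeminorm.toAddGroupSeminorm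

noncomputable instance : NormedSpace ℂ (HaagerupAlg V W) where
  norm_smul_le a _ := haagerupNorm_smul_le a _

noncomputable instance : MatrixNormedSpace (HaagerupAlg V W) where
  matNorm := haagerupNorm
  matNorm_add_le := haagerupNorm_add_le
  matNorm_smul := eq_mul_of_smul_le _ haagerupNorm_zero haagerupNorm_smul_le
  matNorm_matAct_le := haagerupNorm_matAct_le
  matNorm_one_one A := by
    have e : A = Matrix.of fun (_ _ : Fin 1) => A 0 0 := by
      ext i j
      rw [Subsingleton.elim i 0, Subsingleton.elim j 0, Matrix.of_apply]
    conv_lhs => rw [e]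
    rfl

end Haagerup

/-- The Haagerup tensor product of `V` and `W`: the completion of the algebraic tensor product
with the Haagerup matrix-norm. -/
abbrev HaagerupTensor (V W : Type*) [NormedAddCommGroup V] [NormedSpace ℂ V]
    [MatrixNormedSpace V] [NormedAddCommGroup W] [NormedSpace ℂ W] [MatrixNormedSpace W] :
    Type _ := UniformSpace.Completion (HaagerupAlg V W)

/-! All norms involved, except those on completions, are infima over decompositions, so a
subadditive function is bounded by such a norm once it is bounded on the generators
(`le_mul_decompInf`). Everything then reduces to the generators `(v ⊗ w) ⊗ C` and to the identity
`(v ⊗ C) ⊙ (w ⊗ D) = (v ⊗ w) ⊗ CD` (`odot_vecTensor`).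

From the projective to the Haagerup side, the trace norm of `C` is the infimum of `∑ ‖aₗ‖ ‖bₗ‖` over
`C = ∑ aₗ bₗ` with columns `aₗ` and rows `bₗ` (`rankOneNorm_le_traceNorm`, by Hahn-Banach and trace
duality). For columns and rows the trace norm is at most the Euclidean norm, so the factorizations
`(v ⊗ aₗ) ⊙ (w ⊗ bₗ)` cost at most `‖v‖ ‖w‖ ‖aₗ‖ ‖bₗ‖`; this gives `haagerupNorm_vecTensor_le`.

In the other direction, submultiplicativity of the trace norm (`traceNorm_mul_le`) bounds the AMAX
norm of `(v ⊗ w) ⊗ CD` by the product of the norms of the factors; this gives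
`matNorm_haagerupToProjMatrix_le`.

At the scalar level the two estimates give an isometry of algebraic tensor products, which extends
to the completions; density and continuity carry both estimates over to all matrices. -/

/-! ### Bounding subadditive functions by decomposition infima -/

lemma le_mul_decompInf {T M : Type*} [AddCommMonoid M] {val : T → M} {cost : T → ℝ}
    (h : AddSubmonoid.closure (Set.range val) = ⊤) {p : M → ℝ} (p_zero : p 0 ≤ 0)
    (p_add : ∀ x y, p (x + y) ≤ p x + p y) {r : ℝ} (hr : 0 ≤ r)
    (hp : ∀ t, p (val t) ≤ r * cost t) (x : M) : p x ≤ r * decompInf val cost x := by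
  have key : ∀ L : List T, p (L.map val).sum ≤ r * (L.map cost).sum := by
    intro L
    induction L with
    | nil => simpa using p_zero
    | cons t L ih =>
      rw [List.map_cons, List.sum_cons, List.map_cons, List.sum_cons, mul_add]
      exact (p_add _ _).trans (add_le_add (hp t) ih)
  -- For `r = 0` one cannot divide by `r`, but a single decomposition already gives the bound.
  rcases hr.eq_or_lt with rfl | hr
  · obtain ⟨L, rfl⟩ := exists_decomp h x
    simpa using key L
  · rw [mul_comm, ← div_le_iff₀ hr]
    refine le_decompInf h fun L hL => ?_
    rw [div_le_iff₀ hr, mul_comm, hL]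
    exact key L

/-! ### Rank-one decompositions and the trace norm -/

/-- Hahn-Banach in the space seminormed by `p`. Asking only for norm at most one for the functional
covers the case `p x = 0`. -/
lemma Seminorm.exists_dual_apply_eq {E : Type*} [AddCommGroup E] [Module ℂ E] (p : Seminorm ℂ E)
    (x : E) : ∃ f : E →ₗ[ℂ] ℂ, f x = p x ∧ ∀ y, ‖f y‖ ≤ p y := by
  let : SeminormedAddCommGroup E := p.toAddGroupSeminorm.toSeminormedAddCommGroup
  let : NormedSpace ℂ E := ⟨fun a y => (map_smul_eq_mul p a y).le⟩
  obtain ⟨g, hg, hx⟩ := exists_dual_vector'' ℂ x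
  exact ⟨g, hx, fun y => (g.le_of_opNorm_le hg y).trans_eq (one_mul _)⟩

section RankOne

open scoped Matrix.Norms.L2Operator

variable {m n : ℕ}

lemma opNorm_conjTranspose (A : Matrix (Fin m) (Fin n) ℂ) : opNorm A.conjTranspose = opNorm A :=
  Matrix.l2_opNorm_conjTranspose A

/-- By the C*-identity, since the Gram matrix of a single column is the `1 × 1` matrix `‖u‖²`. -/
lemma opNorm_replicateCol (u : EuclideanSpace ℂ (Fin n)) :
    opNorm (Matrix.replicateCol (Fin 1) u.ofLp) = ‖u‖ := by
  have h := Matrix.l2_opNorm_conjTranspose_mul_self (Matrix.replicateCol (Fin 1) u.ofLp)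
  have e : (Matrix.replicateCol (Fin 1) u.ofLp).conjTranspose * Matrix.replicateCol (Fin 1) u.ofLp
      = Matrix.diagonal fun _ => ((‖u‖ ^ 2 : ℝ) : ℂ) := by
    ext i j
    rw [Subsingleton.elim i 0, Subsingleton.elim j 0, Matrix.diagonal_apply_eq,
      EuclideanSpace.norm_sq_eq, Matrix.mul_apply]
    push_cast
    refine Finset.sum_congr rfl fun k _ => ?_
    exact Complex.conj_mul' _
  rw [e, Matrix.l2_opNorm_diagonal, pi_norm_const, Complex.norm_real, Real.norm_of_nonneg
    (sq_nonneg _), sq] at h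
  exact (mul_self_inj (opNorm_nonneg _) (norm_nonneg u)).1 h.symm

/-- Testing with the column `u` and the row `(Du)*` gives trace `‖Du‖²`, hence `‖Du‖² ≤ ‖u‖ ‖Du‖`.
-/
lemma opNorm_le_one_of_trace_le (D : Matrix (Fin n) (Fin m) ℂ)
    (h : ∀ (A : Matrix (Fin m) (Fin 1) ℂ) (B : Matrix (Fin 1) (Fin n) ℂ),
      ‖(A * B * D).trace‖ ≤ opNorm A * opNorm B) : opNorm D ≤ 1 := by
  refine ContinuousLinearMap.opNorm_le_bound _ zero_le_one fun u => ?_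
  set v : EuclideanSpace ℂ (Fin n) := WithLp.toLp 2 (D.mulVec u.ofLp) with hv
  change ‖v‖ ≤ 1 * ‖u‖
  have := h (Matrix.replicateCol (Fin 1) u.ofLp) (Matrix.replicateCol (Fin 1) v.ofLp).conjTranspose
  rw [opNorm_conjTranspose, opNorm_replicateCol, opNorm_replicateCol, Matrix.mul_assoc,
    Matrix.trace_mul_comm, Matrix.mul_assoc, ← Matrix.replicateCol_mulVec, Matrix.trace_fin_one,
    Matrix.mul_apply] at this
  have e : ∑ k, (Matrix.replicateCol (Fin 1) v.ofLp).conjTranspose 0 k *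
      Matrix.replicateCol (Fin 1) (D.mulVec u.ofLp) k 0 = ((‖v‖ ^ 2 : ℝ) : ℂ) := by
    rw [EuclideanSpace.norm_sq_eq]
    push_cast
    exact Finset.sum_congr rfl fun k _ => Complex.conj_mul' _
  rw [e, Complex.norm_real, Real.norm_of_nonneg (sq_nonneg _), sq] at this
  rw [one_mul]
  -- Arguing by contradiction avoids dividing by `‖v‖`, which may vanish.
  by_contra hlt
  push Not at hlt
  nlinarith [norm_nonneg u, norm_nonneg v]

/-- The infimum of `∑ ‖Aₗ‖ ‖Bₗ‖` over all decompositions `C = ∑ Aₗ Bₗ` into products of a column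
and a row. -/
noncomputable def rankOneNorm (C : Matrix (Fin m) (Fin n) ℂ) : ℝ :=
  decompInf (fun t : Matrix (Fin m) (Fin 1) ℂ × Matrix (Fin 1) (Fin n) ℂ => t.1 * t.2)
    (fun t => opNorm t.1 * opNorm t.2) C

lemma closure_rankOne : AddSubmonoid.closure (Set.range
    fun t : Matrix (Fin m) (Fin 1) ℂ × Matrix (Fin 1) (Fin n) ℂ => t.1 * t.2) = ⊤ :=
  closure_of_single _ fun i j c => AddSubmonoid.subset_closure
    ⟨(Matrix.single i 0 c, Matrix.single 0 j 1), by simp⟩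

lemma rankOne_cost_nonneg (t : Matrix (Fin m) (Fin 1) ℂ × Matrix (Fin 1) (Fin n) ℂ) :
    0 ≤ opNorm t.1 * opNorm t.2 :=
  mul_nonneg (opNorm_nonneg _) (opNorm_nonneg _)

lemma rankOneNorm_mul_le (A : Matrix (Fin m) (Fin 1) ℂ) (B : Matrix (Fin 1) (Fin n) ℂ) :
    rankOneNorm (A * B) ≤ opNorm A * opNorm B :=
  decompInf_val_le (val := fun t : Matrix (Fin m) (Fin 1) ℂ × Matrix (Fin 1) (Fin n) ℂ =>
    t.1 * t.2) rankOne_cost_nonneg (A, B)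

lemma opNorm_smul (a : ℂ) (A : Matrix (Fin m) (Fin n) ℂ) : opNorm (a • A) = ‖a‖ * opNorm A :=
  norm_smul a A

/-- The norm given by decompositions into products of a column and a row, as a seminorm. -/
noncomputable def rankOneSeminorm : Seminorm ℂ (Matrix (Fin m) (Fin n) ℂ) :=
  .ofSMulLE rankOneNorm (decompInf_zero rankOne_cost_nonneg)
    (decompInf_add_le rankOne_cost_nonneg closure_rankOne) fun a C =>
      decompInf_smul_le rankOne_cost_nonneg closure_rankOne a (fun t => (a • t.1, t.2))
        (fun t => (Matrix.smul_mul a t.1 t.2).symm)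
        (fun t => by rw [opNorm_smul, mul_assoc]) C

lemma exists_trace_eq (f : Matrix (Fin m) (Fin n) ℂ →ₗ[ℂ] ℂ) :
    ∃ D : Matrix (Fin n) (Fin m) ℂ, ∀ C, f C = (C * D).trace := by
  -- The indices are transposed because `tr (CD) = ∑ C i j * D j i`.
  refine ⟨Matrix.of fun j i => f (Matrix.single i j 1), fun C => ?_⟩
  conv_lhs => rw [Matrix.matrix_eq_sum_single C]
  simp only [map_sum, Matrix.trace, Matrix.diag_apply, Matrix.mul_apply, Matrix.of_apply]
  refine Finset.sum_congr rfl fun i _ => Finset.sum_congr rfl fun j _ => ?_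
  rw [← smul_eq_mul, ← map_smul, Matrix.smul_single, smul_eq_mul, mul_one]

/-- The trace norm is attained by decompositions into products of a column and a row. -/
lemma rankOneNorm_le_traceNorm (C : Matrix (Fin m) (Fin n) ℂ) : rankOneNorm C ≤ traceNorm C := by
  obtain ⟨f, hf, hle⟩ := (rankOneSeminorm (m := m) (n := n)).exists_dual_apply_eq C
  obtain ⟨D, hD⟩ := exists_trace_eq f
  -- The norming functional is dominated by `rankOneNorm`, hence by `‖A‖ ‖B‖` on products `AB`, so
  -- the matrix representing it is a contraction.
  have h1 : opNorm D ≤ 1 := opNorm_le_one_of_trace_le D fun A B => by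
    rw [← hD]
    exact (hle _).trans (rankOneNorm_mul_le A B)
  have h0 : 0 ≤ rankOneNorm C := decompInf_nonneg rankOne_cost_nonneg C
  calc rankOneNorm C = ‖f C‖ := by
        rw [hf, Complex.norm_real]
        exact (Real.norm_of_nonneg h0).symm
    _ ≤ traceNorm C * opNorm D := by rw [hD]; exact norm_trace_mul_le C D
    _ ≤ traceNorm C := mul_le_of_le_one_right (traceNorm_nonneg C) h1

/-! ### Comparison of the trace norm with the operator norm -/

lemma opNorm_zero_le : opNorm (0 : Matrix (Fin m) (Fin n) ℂ) ≤ 0 := by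
  simpa using (opNorm_smul 0 (0 : Matrix (Fin m) (Fin n) ℂ)).le

lemma opNorm_add_le (A B : Matrix (Fin m) (Fin n) ℂ) : opNorm (A + B) ≤ opNorm A + opNorm B :=
  norm_add_le A B

/-- The operator norm is subadditive and at most the cost on each product of a column and a row, so
it lies below `rankOneNorm`. -/
lemma opNorm_le_traceNorm (C : Matrix (Fin m) (Fin n) ℂ) : opNorm C ≤ traceNorm C := by
  have h := le_mul_decompInf closure_rankOne opNorm_zero_le opNorm_add_le zero_le_one
    (fun t : Matrix (Fin m) (Fin 1) ℂ × Matrix (Fin 1) (Fin n) ℂ =>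
      (opNorm_mul_le t.1 t.2).trans_eq (one_mul _).symm) C
  rw [one_mul] at h
  exact h.trans (rankOneNorm_le_traceNorm C)

/-- The ideal property with `opNorm C` weakened to `traceNorm C`. No factor depending on the inner
dimension appears, which the Haagerup infimum over all `q` requires. -/
lemma traceNorm_mul_le {l : ℕ} (C : Matrix (Fin m) (Fin n) ℂ) (D : Matrix (Fin n) (Fin l) ℂ) :
    traceNorm (C * D) ≤ traceNorm C * traceNorm D := by
  have h := traceNorm_mul_mul_le C D (1 : Matrix (Fin l) (Fin l) ℂ)
  rw [Matrix.mul_one] at h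
  refine h.trans ((mul_le_of_le_one_right (mul_nonneg (opNorm_nonneg C) (traceNorm_nonneg D))
    (opNorm_one_le l)).trans ?_)
  exact mul_le_mul_of_nonneg_right (opNorm_le_traceNorm C) (traceNorm_nonneg D)

/-- A column factors through the `1 × 1` identity, whose trace norm is at most one. -/
lemma traceNorm_col_le (A : Matrix (Fin m) (Fin 1) ℂ) : traceNorm A ≤ opNorm A := by
  have h := traceNorm_mul_mul_le A 1 (1 : Matrix (Fin 1) (Fin 1) ℂ)
  rw [Matrix.mul_one, Matrix.mul_one] at h
  refine h.trans ((mul_le_of_le_one_right (mul_nonneg (opNorm_nonneg A) (traceNorm_nonneg 1))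
    (opNorm_one_le 1)).trans ?_)
  exact mul_le_of_le_one_right (opNorm_nonneg A) traceNorm_one_one_le

lemma traceNorm_row_le (B : Matrix (Fin 1) (Fin n) ℂ) : traceNorm B ≤ opNorm B := by
  have h := traceNorm_mul_mul_le (1 : Matrix (Fin 1) (Fin 1) ℂ) 1 B
  rw [Matrix.mul_one, Matrix.one_mul] at h
  refine h.trans (mul_le_of_le_one_left (opNorm_nonneg B) ?_)
  exact mul_le_one₀ (opNorm_one_le 1) (traceNorm_nonneg _) traceNorm_one_one_le

end RankOne

/-! ### The Haagerup norm on the algebraic tensor product -/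

section TensorEquiv

open MatrixNormedSpace UniformSpace

variable (V W : Type*) [NormedAddCommGroup V] [NormedSpace ℂ V] [NormedAddCommGroup W]
  [NormedSpace ℂ W]

/-- The identity map of `V`, with values in `AMAX(V)`. -/
noncomputable def toAMAX : V ≃ₗ[ℂ] AMAX V := LinearEquiv.refl ℂ V

/-- The identity map of `V ⊗ W`, from the projective to the Haagerup tensor product. -/
noncomputable def projToHaagerup : ProjTensorAlg V W ≃ₗ[ℂ] HaagerupAlg (AMAX V) (AMAX W) :=
  (TensorProduct.congr (toAMAX V) (toAMAX W) : V ⊗[ℂ] W ≃ₗ[ℂ] AMAX V ⊗[ℂ] AMAX W)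

variable {V W} {m n : ℕ}

/-- The elementary tensor `v ⊗ w`, as an element of the Haagerup tensor product. -/
noncomputable def haagerupTmul (v : AMAX V) (w : AMAX W) : HaagerupAlg (AMAX V) (AMAX W) :=
  (v ⊗ₜ[ℂ] w : AMAX V ⊗[ℂ] AMAX W)

lemma projToHaagerup_projTmul (t : V × W) : projToHaagerup V W (projTmul t) =
    haagerupTmul (toAMAX V t.1) (toAMAX W t.2) := rfl

lemma projToHaagerup_symm_tmul (v : AMAX V) (w : AMAX W) :
    (projToHaagerup V W).symm (haagerupTmul v w) =
      projTmul ((toAMAX V).symm v, (toAMAX W).symm w) := rfl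

lemma vecTensor_zero_right {E : Type*} [AddCommGroup E] [Module ℂ E] (x : E) :
    vecTensor (x, (0 : Matrix (Fin m) (Fin n) ℂ)) = 0 := by
  ext i j; simp [vecTensor]

lemma vecTensor_add_right {E : Type*} [AddCommGroup E] [Module ℂ E] (x : E)
    (C D : Matrix (Fin m) (Fin n) ℂ) :
    vecTensor (x, C + D) = vecTensor (x, C) + vecTensor (x, D) := by
  ext i j; simp [vecTensor, add_smul]

lemma vecTensor_zero_left {E : Type*} [AddCommGroup E] [Module ℂ E]
    (C : Matrix (Fin m) (Fin n) ℂ) : vecTensor ((0 : E), C) = 0 := by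
  ext i j; simp [vecTensor]

lemma vecTensor_add_left {E : Type*} [AddCommGroup E] [Module ℂ E] (x y : E)
    (C : Matrix (Fin m) (Fin n) ℂ) :
    vecTensor (x + y, C) = vecTensor (x, C) + vecTensor (y, C) := by
  ext i j; simp [vecTensor]

lemma matNorm_vecTensor_le (v : AMAX V) (C : Matrix (Fin m) (Fin n) ℂ) :
    matNorm (vecTensor (v, C)) ≤ ‖v‖ * traceNorm C :=
  decompInf_val_le (val := vecTensor (V := V)) amax_cost_nonneg (v, C)

/-- The maximality of the AMAX norm: bounds need only be checked on matrices `v ⊗ C`. -/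
lemma le_mul_matNorm_amax {p : Matrix (Fin m) (Fin n) (AMAX V) → ℝ} (p_zero : p 0 ≤ 0)
    (p_add : ∀ A B, p (A + B) ≤ p A + p B) {r : ℝ} (hr : 0 ≤ r)
    (hp : ∀ (v : AMAX V) C, p (vecTensor (v, C)) ≤ r * (‖v‖ * traceNorm C))
    (A : Matrix (Fin m) (Fin n) (AMAX V)) : p A ≤ r * matNorm A :=
  le_mul_decompInf (closure_vecTensor (V := V)) p_zero p_add hr (fun t => hp t.1 t.2) A

/-! ### The Haagerup norm is at most the AMAX norm on generators -/

lemma odot_vecTensor {q : ℕ} (v : AMAX V) (w : AMAX W) (C : Matrix (Fin m) (Fin q) ℂ)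
    (D : Matrix (Fin q) (Fin n) ℂ) :
    odot ⟨q, vecTensor (v, C), vecTensor (w, D)⟩ =
      vecTensor (haagerupTmul v w, C * D) := by
  ext i k
  change (∑ j, ((C i j • v) ⊗ₜ[ℂ] (D j k • w) : AMAX V ⊗[ℂ] AMAX W)) =
    (C * D) i k • (v ⊗ₜ[ℂ] w : AMAX V ⊗[ℂ] AMAX W)
  simp only [TensorProduct.smul_tmul_smul, Matrix.mul_apply, Finset.sum_smul]

/-- The tensor is fixed and `C` is split into products of a column and a row; each gives a
factorization through inner dimension `1`, where passing from trace to operator norms costs nothing.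
-/
lemma haagerupNorm_tmul_le (t : V × W) (C : Matrix (Fin m) (Fin n) ℂ) :
    haagerupNorm (vecTensor (projToHaagerup V W (projTmul t), C)) ≤
      traceNorm C * (‖t.1‖ * ‖t.2‖) := by
  have h0 : 0 ≤ ‖t.1‖ * ‖t.2‖ := proj_cost_nonneg t
  rw [mul_comm]
  refine (le_mul_decompInf closure_rankOne
    (p := fun C => haagerupNorm (vecTensor (projToHaagerup V W (projTmul t), C))) ?_ (fun C D => ?_)
    h0 (fun s => ?_) C).trans (mul_le_mul_of_nonneg_left (rankOneNorm_le_traceNorm C) h0)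
  · rw [vecTensor_zero_right, haagerupNorm_zero]
  · rw [vecTensor_add_right]
    exact haagerupNorm_add_le _ _
  · rw [projToHaagerup_projTmul]
    have e := odot_vecTensor (toAMAX V t.1) (toAMAX W t.2) s.1 s.2
    refine (e ▸ decompInf_val_le (val := odot) pairCost_nonneg _).trans ?_
    have h1 : matNorm (vecTensor (toAMAX V t.1, s.1)) ≤ ‖t.1‖ * opNorm s.1 :=
      (matNorm_vecTensor_le _ _).trans
        (mul_le_mul_of_nonneg_left (traceNorm_col_le _) (norm_nonneg t.1))
    have h2 : matNorm (vecTensor (toAMAX W t.2, s.2)) ≤ ‖t.2‖ * opNorm s.2 :=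
      (matNorm_vecTensor_le _ _).trans
        (mul_le_mul_of_nonneg_left (traceNorm_row_le _) (norm_nonneg t.2))
    refine (mul_le_mul h1 h2 (matNorm_nonneg _)
      (mul_nonneg (norm_nonneg _) (opNorm_nonneg _))).trans_eq ?_
    ring

/-- Now `C` is fixed and `x` is split into elementary tensors. -/
lemma haagerupNorm_vecTensor_le (x : ProjTensorAlg V W) (C : Matrix (Fin m) (Fin n) ℂ) :
    haagerupNorm (vecTensor (projToHaagerup V W x, C)) ≤ traceNorm C * ‖x‖ := by
  refine le_mul_decompInf closure_projTmul
    (p := fun x => haagerupNorm (vecTensor (projToHaagerup V W x, C))) ?_ (fun x y => ?_)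
    (traceNorm_nonneg C) (fun t => haagerupNorm_tmul_le t C) x
  · rw [map_zero, vecTensor_zero_left, haagerupNorm_zero]
  · rw [map_add, vecTensor_add_left]
    exact haagerupNorm_add_le _ _

/-! ### The AMAX norm is at most the Haagerup norm -/

/-- The canonical map from `V ⊗ W`, as used for the Haagerup norm, to the projective tensor
product, on matrices. -/
noncomputable def haagerupToProjMatrix :
    Matrix (Fin m) (Fin n) (HaagerupAlg (AMAX V) (AMAX W)) →ₗ[ℂ]
      Matrix (Fin m) (Fin n) (AMAX (ProjTensor V W)) :=
  ((toAMAX (ProjTensor V W)).toLinearMap ∘ₗ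
    (Completion.toComplₗᵢ (𝕜 := ℂ) (E := ProjTensorAlg V W)).toLinearMap ∘ₗ
      (projToHaagerup V W).symm.toLinearMap).mapMatrix

lemma norm_projTmul_le (t : V × W) : ‖projTmul t‖ ≤ ‖t.1‖ * ‖t.2‖ :=
  decompInf_val_le proj_cost_nonneg t

lemma haagerupToProjMatrix_vecTensor (x : HaagerupAlg (AMAX V) (AMAX W))
    (C : Matrix (Fin m) (Fin n) ℂ) : haagerupToProjMatrix (vecTensor (x, C)) =
      vecTensor (toAMAX (ProjTensor V W) ((projToHaagerup V W).symm x : ProjTensorAlg V W), C) := by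
  ext i j
  exact map_smul ((toAMAX (ProjTensor V W)).toLinearMap ∘ₗ
    (Completion.toComplₗᵢ (𝕜 := ℂ) (E := ProjTensorAlg V W)).toLinearMap ∘ₗ
      (projToHaagerup V W).symm.toLinearMap) (C i j) x

lemma matNorm_tmul_le (v : AMAX V) (w : AMAX W) (C : Matrix (Fin m) (Fin n) ℂ) :
    matNorm (haagerupToProjMatrix (vecTensor (haagerupTmul v w, C))) ≤ ‖v‖ * ‖w‖ * traceNorm C := by
  rw [haagerupToProjMatrix_vecTensor]
  refine (matNorm_vecTensor_le _ _).trans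
    (mul_le_mul_of_nonneg_right ?_ (traceNorm_nonneg C))
  rw [projToHaagerup_symm_tmul]
  exact (Completion.norm_coe _).trans_le (norm_projTmul_le _)

lemma odot_zero_left {q : ℕ} (B : Matrix (Fin q) (Fin n) (AMAX W)) :
    odot ⟨q, (0 : Matrix (Fin m) (Fin q) (AMAX V)), B⟩ = 0 := by
  ext i k
  change (∑ j, (0 ⊗ₜ[ℂ] B j k : AMAX V ⊗[ℂ] AMAX W)) = 0
  simp only [TensorProduct.zero_tmul, Finset.sum_const_zero]

lemma odot_zero_right {q : ℕ} (A : Matrix (Fin m) (Fin q) (AMAX V)) :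
    odot ⟨q, A, (0 : Matrix (Fin q) (Fin n) (AMAX W))⟩ = 0 := by
  ext i k
  change (∑ j, (A i j ⊗ₜ[ℂ] 0 : AMAX V ⊗[ℂ] AMAX W)) = 0
  simp only [TensorProduct.tmul_zero, Finset.sum_const_zero]

lemma odot_add_left {q : ℕ} (A A' : Matrix (Fin m) (Fin q) (AMAX V))
    (B : Matrix (Fin q) (Fin n) (AMAX W)) :
    odot ⟨q, A + A', B⟩ = odot ⟨q, A, B⟩ + odot ⟨q, A', B⟩ := by
  ext i k
  change (∑ j, ((A i j + A' i j) ⊗ₜ[ℂ] B j k : AMAX V ⊗[ℂ] AMAX W)) =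
    (∑ j, (A i j ⊗ₜ[ℂ] B j k : AMAX V ⊗[ℂ] AMAX W)) +
      ∑ j, (A' i j ⊗ₜ[ℂ] B j k : AMAX V ⊗[ℂ] AMAX W)
  simp only [TensorProduct.add_tmul, Finset.sum_add_distrib]

lemma odot_add_right {q : ℕ} (A : Matrix (Fin m) (Fin q) (AMAX V))
    (B B' : Matrix (Fin q) (Fin n) (AMAX W)) :
    odot ⟨q, A, B + B'⟩ = odot ⟨q, A, B⟩ + odot ⟨q, A, B'⟩ := by
  ext i k
  change (∑ j, (A i j ⊗ₜ[ℂ] (B j k + B' j k) : AMAX V ⊗[ℂ] AMAX W)) =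
    (∑ j, (A i j ⊗ₜ[ℂ] B j k : AMAX V ⊗[ℂ] AMAX W)) +
      ∑ j, (A i j ⊗ₜ[ℂ] B' j k : AMAX V ⊗[ℂ] AMAX W)
  simp only [TensorProduct.tmul_add, Finset.sum_add_distrib]

/-- The bilinear estimate is obtained one variable at a time: here `A` is decomposed against an
elementary right factor; `matNorm_odot_le` then decomposes `B`. -/
lemma matNorm_odot_vecTensor_le {q : ℕ} (A : Matrix (Fin m) (Fin q) (AMAX V)) (w : AMAX W)
    (D : Matrix (Fin q) (Fin n) ℂ) :
    matNorm (haagerupToProjMatrix (odot ⟨q, A, vecTensor (w, D)⟩)) ≤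
      matNorm A * (‖w‖ * traceNorm D) := by
  rw [mul_comm]
  refine le_mul_matNorm_amax
    (p := fun A => matNorm (haagerupToProjMatrix (odot ⟨q, A, vecTensor (w, D)⟩)))
    ?_ (fun A A' => ?_) (mul_nonneg (norm_nonneg w) (traceNorm_nonneg D)) (fun v C => ?_) A
  · rw [odot_zero_left, map_zero, matNorm_zero]
  · rw [odot_add_left, map_add]
    exact matNorm_add_le _ _
  · rw [odot_vecTensor]
    refine (matNorm_tmul_le _ _ _).trans ?_
    refine (mul_le_mul_of_nonneg_left (traceNorm_mul_le _ _)
      (mul_nonneg (norm_nonneg _) (norm_nonneg _))).trans_eq ?_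
    ring

lemma matNorm_odot_le {q : ℕ} (A : Matrix (Fin m) (Fin q) (AMAX V))
    (B : Matrix (Fin q) (Fin n) (AMAX W)) :
    matNorm (haagerupToProjMatrix (odot ⟨q, A, B⟩)) ≤ matNorm A * matNorm B := by
  refine le_mul_matNorm_amax
    (p := fun B => matNorm (haagerupToProjMatrix (odot ⟨q, A, B⟩))) ?_ (fun B B' => ?_)
    (matNorm_nonneg A) (fun w D => matNorm_odot_vecTensor_le A w D) B
  · rw [odot_zero_right, map_zero, matNorm_zero]
  · rw [odot_add_right, map_add]
    exact matNorm_add_le _ _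

lemma matNorm_haagerupToProjMatrix_le
    (A : Matrix (Fin m) (Fin n) (HaagerupAlg (AMAX V) (AMAX W))) :
    matNorm (haagerupToProjMatrix A) ≤ matNorm A := by
  have h := le_mul_decompInf closure_odot (cost := pairCost)
    (p := fun A : Matrix (Fin m) (Fin n) (HaagerupAlg (AMAX V) (AMAX W)) =>
      matNorm (haagerupToProjMatrix A)) (by rw [map_zero, matNorm_zero])
    (fun A B => by rw [map_add]; exact matNorm_add_le _ _) zero_le_one
    (fun t => (matNorm_odot_le t.2.1 t.2.2).trans_eq (one_mul _).symm) A
  rwa [one_mul] at h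

/-- The two estimates for `1 × 1` matrices; this makes the extension to the completions possible. -/
lemma norm_projToHaagerup (x : ProjTensorAlg V W) : ‖projToHaagerup V W x‖ = ‖x‖ := by
  refine le_antisymm ?_ ?_
  · have h := haagerupNorm_vecTensor_le x (1 : Matrix (Fin 1) (Fin 1) ℂ)
    refine Eq.trans_le ?_ (h.trans (mul_le_of_le_one_left (norm_nonneg x) traceNorm_one_one_le))
    refine Eq.trans ?_ (matNorm_one_one (vecTensor (projToHaagerup V W x, 1))).symm
    change _ = ‖(1 : ℂ) • projToHaagerup V W x‖
    rw [one_smul]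
  · have h := matNorm_haagerupToProjMatrix_le
      (Matrix.of fun (_ _ : Fin 1) => projToHaagerup V W x)
    rw [matNorm_one_one, matNorm_one_one, Matrix.of_apply] at h
    refine Eq.trans_le ?_ h
    change _ = ‖(((projToHaagerup V W).symm (projToHaagerup V W x) : ProjTensorAlg V W) :
      ProjTensor V W)‖
    rw [LinearEquiv.symm_apply_apply, Completion.norm_coe]

/-! ### Passage to the completions -/

variable (V W) in
/-- The isometric isomorphism of the completions extending the identity map of `V ⊗ W`. -/
noncomputable def amaxProjEquiv : ProjTensor V W ≃ₗᵢ[ℂ] HaagerupTensor (AMAX V) (AMAX W) :=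
  (projToHaagerup V W).extendOfIsometry
    (Completion.toComplₗᵢ (𝕜 := ℂ)).toLinearMap (Completion.toComplₗᵢ (𝕜 := ℂ)).toLinearMap
    Completion.denseRange_coe Completion.denseRange_coe fun x => by
      simpa [Completion.norm_coe] using norm_projToHaagerup x

lemma amaxProjEquiv_coe (x : ProjTensorAlg V W) : amaxProjEquiv V W x = projToHaagerup V W x :=
  LinearEquiv.extendOfIsometry_eq _ _ _ _ _ _ x

lemma continuous_map_amaxProjEquiv : Continuous fun A : Matrix (Fin m) (Fin n) (ProjTensor V W) =>
    A.map (amaxProjEquiv V W) :=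
  continuous_id.matrix_map (amaxProjEquiv V W).continuous

/-- Decompositions for the AMAX norm of `ProjTensor V W` use vectors of the completion, so the bound
on generators is first extended from algebraic tensors by continuity in `x`. -/
lemma matNorm_map_amaxProjEquiv_vecTensor_le (x : ProjTensor V W) (C : Matrix (Fin m) (Fin n) ℂ) :
    matNorm ((vecTensor (x, C)).map (amaxProjEquiv V W)) ≤ ‖x‖ * traceNorm C := by
  refine Completion.induction_on x (isClosed_le ?_ (continuous_norm.mul continuous_const))
    fun x => ?_
  · refine uniformContinuous_matNorm.continuous.comp (continuous_map_amaxProjEquiv.comp ?_)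
    exact continuous_matrix fun i j => continuous_const_smul (C i j)
  · have e : (vecTensor ((x : ProjTensor V W), C)).map (amaxProjEquiv V W) =
        toComplMatrix (vecTensor (projToHaagerup V W x, C)) := by
      ext i j
      change amaxProjEquiv V W (C i j • (x : ProjTensor V W)) =
        ((C i j • projToHaagerup V W x : HaagerupAlg (AMAX V) (AMAX W)) : Completion _)
      rw [map_smul, amaxProjEquiv_coe, Completion.coe_smul]
    rw [e, Completion.norm_coe, mul_comm]
    exact (complMatNorm_toComplMatrix _).trans_le (haagerupNorm_vecTensor_le x C)

lemma matNorm_map_amaxProjEquiv_le (A : Matrix (Fin m) (Fin n) (ProjTensor V W)) :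
    matNorm (A.map (amaxProjEquiv V W)) ≤ amaxNorm A := by
  have h := le_mul_decompInf (closure_vecTensor (V := ProjTensor V W))
    (p := fun A : Matrix (Fin m) (Fin n) (ProjTensor V W) => matNorm (A.map (amaxProjEquiv V W)))
    (by rw [Matrix.map_zero _ (map_zero _), matNorm_zero])
    (fun A B => by rw [Matrix.map_add _ (map_add _)]; exact matNorm_add_le _ _) zero_le_one
    (fun t => (matNorm_map_amaxProjEquiv_vecTensor_le t.1 t.2).trans_eq (one_mul _).symm) A
  rwa [one_mul] at h

/-- Both sides are continuous in the entries of `A`, so matrices of algebraic tensors suffice; there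
`haagerupToProjMatrix` inverts the map and is contractive. -/
lemma amaxNorm_le_matNorm_map (A : Matrix (Fin m) (Fin n) (ProjTensor V W)) :
    amaxNorm A ≤ matNorm (A.map (amaxProjEquiv V W)) := by
  refine denseRange_toComplMatrix.induction_on
    (p := fun A => amaxNorm A ≤ matNorm (A.map (amaxProjEquiv V W))) A
    (isClosed_le ?_ ?_) fun A => ?_
  · exact (uniformContinuous_matNorm (V := AMAX (ProjTensor V W))).continuous
  · exact uniformContinuous_matNorm.continuous.comp continuous_map_amaxProjEquiv
  · have e : (toComplMatrix A).map (amaxProjEquiv V W) =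
        toComplMatrix (A.map (projToHaagerup V W)) := by
      ext i j
      exact amaxProjEquiv_coe (A i j)
    have e' : haagerupToProjMatrix (A.map (projToHaagerup V W)) = toComplMatrix A := by
      ext i j
      change (((projToHaagerup V W).symm (projToHaagerup V W (A i j)) : ProjTensorAlg V W) :
        ProjTensor V W) = A i j
      rw [LinearEquiv.symm_apply_apply]
    have h := matNorm_haagerupToProjMatrix_le (A.map (projToHaagerup V W))
    rw [e'] at h
    rw [e]
    exact h.trans_eq (complMatNorm_toComplMatrix _).symm

end TensorEquiv

theorem mainTheorem5 (V W : Type*) [NormedAddCommGroup V] [NormedSpace ℂ V] [CompleteSpace V]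
    [NormedAddCommGroup W] [NormedSpace ℂ W] [CompleteSpace W] :
    ∃ e : AMAX (ProjTensor V W) ≃ₗ[ℂ] HaagerupTensor (AMAX V) (AMAX W),
      CompletelyContractive e.toLinearMap ∧ CompletelyContractive e.symm.toLinearMap := by
  refine ⟨(toAMAX (ProjTensor V W)).symm.trans (amaxProjEquiv V W).toLinearEquiv,
    fun m n A => matNorm_map_amaxProjEquiv_le A, fun m n A => ?_⟩
  -- Contractivity of the inverse is the lower bound for the forward map, taken at the preimage of
  -- `A`.
  refine (amaxNorm_le_matNorm_map (A.map (amaxProjEquiv V W).symm)).trans_eq ?_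
  congr 1
  ext i j
  exact (amaxProjEquiv V W).apply_symm_apply (A i j)
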